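/- **Setting.** Formulas are built from a nonempty set of propositional variables with the connectives $\vee,\wedge,\to$ (binary), $\sim$ (unary) and the constants $\bot,\top$. Abbreviate $\alpha\to_H\beta:=\alpha\to(\alpha\wedge\beta)$, $\ \alpha\leftrightarrow_H\beta:=(\alpha\to_H\beta)\wedge(\beta\to_H\alpha)$ and $\neg\alpha:=\alpha\to\bot$. The logic $\mathcal{DMSH}$ (De Morgan semi-Heyting logic) is given in Hilbert style by the axiom schemes 1. $\alpha\to_H(\alpha\vee\beta)$ 2. $\beta\to_H(\alpha\vee\beta)$ 3. $(\alpha\to_H\gamma)\to_H[(\beta\to_H\gamma)\to_H((\alpha\vee\beta)\to_H\gamma)]$ 4. $(\alpha\wedge\beta)\to_H\alpha$ 5. $(\gamma\to_H\alpha)\to_H[(\gamma\to_H\beta)\to_H(\gamma\to_H(\alpha\wedge\beta))]$ 6. $\top$ 7. $\bot\to_H\alpha$ 8. $[(\alpha\wedge\beta)\to_H\gamma]\to_H[\alpha\to_H(\beta\to_H\gamma)]$ 9. $[\alpha\to_H(\beta\to_H\gamma)]\to_H[(\alpha\wedge\beta)\to_H\gamma]$ 10. $(\alpha\to_H\beta)\to_H[(\beta\to_H\alpha)\to_H((\alpha\to\gamma)\to_H(\beta\to\gamma))]$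 11. $(\alpha\to_H\beta)\to_H[(\beta\to_H\alpha)\to_H((\gamma\to\beta)\to_H(\gamma\to\alpha))]$ 12. $\top\leftrightarrow_H\ \sim\bot$ 13. $\sim(\alpha\wedge\beta)\leftrightarrow_H(\sim\alpha\ \vee\sim\beta)$ 14. $\sim(\alpha\vee\beta)\leftrightarrow_H(\sim\alpha\ \wedge\sim\beta)$ 15. $\sim\sim\alpha\leftrightarrow_H\alpha$ and the two rules of inference: from $\varphi$ and $\varphi\to_H\gamma$ infer $\gamma$; from $\varphi\to_H\gamma$ infer $\sim\gamma\to_H\ \sim\varphi$. The logic $\mathcal{RUNO}1$ has the same rules, and the further axiom schemes 16. $\sim(\bot\to\top)\leftrightarrow_H(\bot\to\top)$ 17. $[(\alpha\ \wedge\sim\neg\sim\alpha)\vee(\beta\vee\neg\beta)]\leftrightarrow_H(\beta\vee\neg\beta)$ 18. $\neg\sim(\alpha\wedge\neg\sim\alpha)\leftrightarrow_H(\alpha\wedge\neg\sim\alpha)$ An *axiomatic extension* of $\mathcal{RUNO}1$ is a logic $\mathcal L$ obtained by adding an arbitrary set of formulas as new axioms (all substitution instances of which may be used in proofs) and keeping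 the rules of inference. Write $\vdash_{\mathcal L}\varphi$ if $\varphi$ is provable in $\mathcal L$ without premises. $\mathcal L$ is *consistent* if $\not\vdash_{\mathcal L}\varphi$ for some formula $\varphi$. $\mathcal L$ has the *disjunction property* if, for all formulas $\alpha,\beta$, $\vdash_{\mathcal L}\alpha\vee\beta$ implies $\vdash_{\mathcal L}\alpha$ or $\vdash_{\mathcal L}\beta$. **Theorem.** No consistent axiomatic extension of $\mathcal{RUNO}1$ has the disjunction property. -/

import Mathlib

/-- Formulas of the propositional language `⟨∨, ∧, →, ∼, ⊥, ⊤⟩` over a set `V` of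
propositional variables. -/
inductive Fm (V : Type*) where
  | var : V → Fm V
  | or : Fm V → Fm V → Fm V
  | and : Fm V → Fm V → Fm V
  | imp : Fm V → Fm V → Fm V
  | neg : Fm V → Fm V
  | bot : Fm V
  | top : Fm V

namespace Fm

infixl:69 " ⋎ " => Fm.or
infixl:70 " ⋏ " => Fm.and
infixr:60 " ⇾ " => Fm.imp
prefix:max "∼" => Fm.neg

/-- `α →_H β := α → (α ∧ β)`. -/
def impH {V : Type*} (α β : Fm V) : Fm V := α ⇾ (α ⋏ β)

infixr:60 " ⇾ₕ " => Fm.impH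

/-- `α ↔_H β := (α →_H β) ∧ (β →_H α)`. -/
def iffH {V : Type*} (α β : Fm V) : Fm V := (α ⇾ₕ β) ⋏ (β ⇾ₕ α)

infix:58 " ⇿ₕ " => Fm.iffH

/-- The defined negation `¬ α := α → ⊥`, as opposed to the primitive negation `∼`. -/
def inot {V : Type*} (α : Fm V) : Fm V := α ⇾ bot

/-- The action on formulas of a substitution, i.e. of the endomorphism of the algebra of formulas
that extends `σ : V → Fm V`. -/
def subst {V : Type*} (σ : V → Fm V) : Fm V → Fm V
  | var v => σ v
  | or α β => or (subst σ α) (subst σ β)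
  | and α β => and (subst σ α) (subst σ β)
  | imp α β => imp (subst σ α) (subst σ β)
  | neg α => neg (subst σ α)
  | bot => bot
  | top => top

end Fm

/-- A presentation of a logic in Hilbert style: a set of axioms, and a set of rules, each with a
finite list of premises and a conclusion. Axioms and rules are used up to substitution. -/
structure HilbertSystem (V : Type*) where
  axioms : Set (Fm V)
  rules : Set (List (Fm V) × Fm V)

namespace HilbertSystem

/-- `H.Derives Γ φ`: there is a formal proof of `φ` from `Γ`. -/
inductive Derives {V : Type*} (H : HilbertSystem V) (Γ : Set (Fm V)) : Fm V → Prop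
  | hyp {φ : Fm V} : φ ∈ Γ → Derives H Γ φ
  | ax {ψ : Fm V} (σ : V → Fm V) : ψ ∈ H.axioms → Derives H Γ (ψ.subst σ)
  | rule {Δ : List (Fm V)} {ψ : Fm V} (σ : V → Fm V) : (Δ, ψ) ∈ H.rules →
      (∀ δ ∈ Δ, Derives H Γ (δ.subst σ)) → Derives H Γ (ψ.subst σ)

/-- `φ` is a theorem of the logic: it is provable without premises. -/
def Provable {V : Type*} (H : HilbertSystem V) (φ : Fm V) : Prop := H.Derives ∅ φ

/-- A logic is consistent if not every formula is a theorem. -/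
def Consistent {V : Type*} (H : HilbertSystem V) : Prop := ∃ φ : Fm V, ¬ H.Provable φ

/-- The disjunction property: if a disjunction is a theorem, then so is one of the disjuncts. -/
def DisjunctionProperty {V : Type*} (H : HilbertSystem V) : Prop :=
  ∀ α β : Fm V, H.Provable (α ⋎ β) → H.Provable α ∨ H.Provable β

/-- `H'` is an axiomatic extension of `H`: it arises from `H` by adding axioms (any set of
formulas) and keeping the rules of inference. -/
def IsAxiomaticExtension {V : Type*} (H' H : HilbertSystem V) : Prop :=
  H.axioms ⊆ H'.axioms ∧ H'.rules = H.rules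

end HilbertSystem

open Fm in
/-- The axiom schemes of De Morgan semi-Heyting logic. -/
inductive DMSHAxiom {V : Type*} : Fm V → Prop
  | or_left (α β : Fm V) : DMSHAxiom (α ⇾ₕ (α ⋎ β))
  | or_right (α β : Fm V) : DMSHAxiom (β ⇾ₕ (α ⋎ β))
  | or_elim (α β γ : Fm V) :
      DMSHAxiom ((α ⇾ₕ γ) ⇾ₕ ((β ⇾ₕ γ) ⇾ₕ ((α ⋎ β) ⇾ₕ γ)))
  | and_left (α β : Fm V) : DMSHAxiom ((α ⋏ β) ⇾ₕ α)
  | and_intro (α β γ : Fm V) :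
      DMSHAxiom ((γ ⇾ₕ α) ⇾ₕ ((γ ⇾ₕ β) ⇾ₕ (γ ⇾ₕ (α ⋏ β))))
  | top_intro : DMSHAxiom top
  | bot_elim (α : Fm V) : DMSHAxiom (bot ⇾ₕ α)
  | curry (α β γ : Fm V) :
      DMSHAxiom (((α ⋏ β) ⇾ₕ γ) ⇾ₕ (α ⇾ₕ (β ⇾ₕ γ)))
  | uncurry (α β γ : Fm V) :
      DMSHAxiom ((α ⇾ₕ (β ⇾ₕ γ)) ⇾ₕ ((α ⋏ β) ⇾ₕ γ))
  | imp_congr_left (α β γ : Fm V) :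
      DMSHAxiom ((α ⇾ₕ β) ⇾ₕ ((β ⇾ₕ α) ⇾ₕ ((α ⇾ γ) ⇾ₕ (β ⇾ γ))))
  | imp_congr_right (α β γ : Fm V) :
      DMSHAxiom ((α ⇾ₕ β) ⇾ₕ ((β ⇾ₕ α) ⇾ₕ ((γ ⇾ β) ⇾ₕ (γ ⇾ α))))
  | neg_bot : DMSHAxiom (top ⇿ₕ ∼bot)
  | neg_and (α β : Fm V) : DMSHAxiom (∼(α ⋏ β) ⇿ₕ (∼α ⋎ ∼β))
  | neg_or (α β : Fm V) : DMSHAxiom (∼(α ⋎ β) ⇿ₕ (∼α ⋏ ∼β))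
  | neg_neg (α : Fm V) : DMSHAxiom (∼(∼α) ⇿ₕ α)

open Fm in
/-- The rules of De Morgan semi-Heyting logic: semi-Modus Ponens and semi-Contraposition. -/
inductive DMSHRule {V : Type*} : List (Fm V) × Fm V → Prop
  | smp (φ γ : Fm V) : DMSHRule ([φ, φ ⇾ₕ γ], γ)
  | scp (φ γ : Fm V) : DMSHRule ([φ ⇾ₕ γ], ∼γ ⇾ₕ ∼φ)

/-- De Morgan semi-Heyting logic. -/
def logicDMSH (V : Type*) : HilbertSystem V where
  axioms := {φ | DMSHAxiom φ}
  rules := {r | DMSHRule r}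

open Fm in
/-- The additional axiom schemes of `RUNO1`: unorthodoxy, regularity and level 1. -/
inductive RUNO1Axiom {V : Type*} : Fm V → Prop
  | unorthodox : RUNO1Axiom (∼(bot ⇾ top) ⇿ₕ (bot ⇾ top))
  | regular (α β : Fm V) :
      RUNO1Axiom (((α ⋏ ∼(inot (∼α))) ⋎ (β ⋎ inot β)) ⇿ₕ (β ⋎ inot β))
  | level_one (α : Fm V) :
      RUNO1Axiom (inot (∼(α ⋏ inot (∼α))) ⇿ₕ (α ⋏ inot (∼α)))

/-- The logic `RUNO1`: regular unorthodox De Morgan semi-Heyting logic of level 1. -/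
def logicRUNO1 (V : Type*) : HilbertSystem V where
  axioms := (logicDMSH V).axioms ∪ {φ | RUNO1Axiom φ}
  rules := (logicDMSH V).rules

open Fm

namespace Fm

variable {V : Type*}

/-! Put `β = p ∧ ¬∼p`. The level 1 axiom gives `β →_H ¬∼β`, so `β ∧ ∼β` is refutable, and
contraposition with De Morgan makes `∼β ∨ ∼∼β` a theorem (`neg_or_neg_neg`). Neither disjunct is a
theorem of a consistent extension: theorems are closed under substitution, and `p := ⊤` turns `β`
into a theorem, while `p := ⊥` turns it into a refutable formula. -/

theorem subst_subst (σ τ : V → Fm V) (φ : Fm V) :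
    (φ.subst σ).subst τ = φ.subst (fun v => (σ v).subst τ) := by
  induction φ <;> simp_all [subst]

theorem subst_var (φ : Fm V) : φ.subst var = φ := by
  induction φ <;> simp_all [subst]

end Fm

namespace HilbertSystem

variable {V : Type*} {L : HilbertSystem V}

/-- Theorems are closed under substitution. -/
theorem Provable.subst {φ : Fm V} (h : L.Provable φ) (τ : V → Fm V) :
    L.Provable (φ.subst τ) := by
  induction h with
  | hyp h => exact absurd h (Set.notMem_empty _)
  | ax σ h => rw [subst_subst]; exact .ax _ h
  | rule σ h _ ih =>
    rw [subst_subst]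
    exact .rule _ h fun δ hδ => by rw [← subst_subst]; exact ih δ hδ

/-- A system whose theorems include the axioms of De Morgan semi-Heyting logic and are closed
under its rules. -/
structure ExtendsDMSH (L : HilbertSystem V) : Prop where
  ax {φ : Fm V} : DMSHAxiom φ → L.Provable φ
  mp {φ ψ : Fm V} : L.Provable (φ ⇾ₕ ψ) → L.Provable φ → L.Provable ψ
  contra {φ ψ : Fm V} : L.Provable (φ ⇾ₕ ψ) → L.Provable (∼ψ ⇾ₕ ∼φ)

theorem provable_of_mem_axioms {φ : Fm V} (h : φ ∈ L.axioms) : L.Provable φ := by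
  have := Derives.ax (Γ := ∅) var h
  rwa [subst_var] at this

theorem provable_of_mem_rules {Δ : List (Fm V)} {φ : Fm V} (h : (Δ, φ) ∈ L.rules)
    (hΔ : ∀ δ ∈ Δ, L.Provable δ) : L.Provable φ := by
  have := Derives.rule (Γ := ∅) var h fun δ hδ => by rw [subst_var]; exact hΔ δ hδ
  rwa [subst_var] at this

theorem IsAxiomaticExtension.extendsDMSH (hL : L.IsAxiomaticExtension (logicRUNO1 V)) :
    L.ExtendsDMSH where
  ax h := provable_of_mem_axioms (hL.1 (Or.inl h))
  mp {φ ψ} h₁ h₂ := by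
    have hr : ([φ, φ ⇾ₕ ψ], ψ) ∈ L.rules := by rw [hL.2]; exact DMSHRule.smp φ ψ
    exact provable_of_mem_rules hr (by simp [h₁, h₂])
  contra {φ ψ} h := by
    have hr : ([φ ⇾ₕ ψ], ∼ψ ⇾ₕ ∼φ) ∈ L.rules := by rw [hL.2]; exact DMSHRule.scp φ ψ
    exact provable_of_mem_rules hr (by simpa using h)

namespace ExtendsDMSH

variable {α β γ : Fm V}

theorem and_left (H : L.ExtendsDMSH) (α β : Fm V) : L.Provable ((α ⋏ β) ⇾ₕ α) :=
  H.ax (.and_left α β)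

theorem curry (H : L.ExtendsDMSH) (h : L.Provable ((α ⋏ β) ⇾ₕ γ)) :
    L.Provable (α ⇾ₕ (β ⇾ₕ γ)) :=
  H.mp (H.ax (.curry α β γ)) h

theorem uncurry (H : L.ExtendsDMSH) (h : L.Provable (α ⇾ₕ (β ⇾ₕ γ))) :
    L.Provable ((α ⋏ β) ⇾ₕ γ) :=
  H.mp (H.ax (.uncurry α β γ)) h

theorem imp_intro (H : L.ExtendsDMSH) (α : Fm V) (h : L.Provable β) : L.Provable (α ⇾ₕ β) :=
  H.mp (H.curry (H.and_left β α)) h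

theorem le_and (H : L.ExtendsDMSH) (h₁ : L.Provable (γ ⇾ₕ α)) (h₂ : L.Provable (γ ⇾ₕ β)) :
    L.Provable (γ ⇾ₕ (α ⋏ β)) :=
  H.mp (H.mp (H.ax (.and_intro α β γ)) h₁) h₂

theorem imp_replace_left (H : L.ExtendsDMSH) (h₁ : L.Provable (α ⇾ₕ β))
    (h₂ : L.Provable (β ⇾ₕ α)) (γ : Fm V) : L.Provable ((α ⇾ γ) ⇾ₕ (β ⇾ γ)) :=
  H.mp (H.mp (H.ax (.imp_congr_left α β γ)) h₁) h₂

theorem imp_replace_right (H : L.ExtendsDMSH) (h₁ : L.Provable (α ⇾ₕ β))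
    (h₂ : L.Provable (β ⇾ₕ α)) (γ : Fm V) : L.Provable ((γ ⇾ α) ⇾ₕ (γ ⇾ β)) :=
  H.mp (H.mp (H.ax (.imp_congr_right β α γ)) h₂) h₁

/-- `α →_H ⊤` unfolds to `α → (α ∧ ⊤)`, whose consequent is equivalent to `α ∧ α`. -/
theorem refl (H : L.ExtendsDMSH) (α : Fm V) : L.Provable (α ⇾ₕ α) := by
  have ht : L.Provable top := H.ax .top_intro
  exact H.mp (H.imp_replace_right (H.le_and (H.and_left α top) (H.and_left α top))
    (H.le_and (H.and_left α α) (H.imp_intro _ ht)) α) (H.imp_intro α ht)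

theorem and_right (H : L.ExtendsDMSH) (α β : Fm V) : L.Provable ((α ⋏ β) ⇾ₕ β) :=
  H.uncurry (H.imp_intro α (H.refl β))

theorem and_mono_right (H : L.ExtendsDMSH) (h : L.Provable (β ⇾ₕ γ)) (α : Fm V) :
    L.Provable ((α ⋏ β) ⇾ₕ (α ⋏ γ)) :=
  H.le_and (H.and_left α β) (H.uncurry (H.imp_intro α h))

theorem impH_replace_right (H : L.ExtendsDMSH) (h₁ : L.Provable (α ⇾ₕ β))
    (h₂ : L.Provable (β ⇾ₕ α)) (γ : Fm V) : L.Provable ((γ ⇾ₕ α) ⇾ₕ (γ ⇾ₕ β)) :=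
  H.imp_replace_right (H.and_mono_right h₁ γ) (H.and_mono_right h₂ γ) γ

/-- Transitivity is not yet available, so `α` is replaced by `β` inside `α →_H (γ →_H α)`. -/
theorem and_left_of_equiv (H : L.ExtendsDMSH) (h₁ : L.Provable (α ⇾ₕ β))
    (h₂ : L.Provable (β ⇾ₕ α)) (γ : Fm V) : L.Provable ((α ⋏ γ) ⇾ₕ β) :=
  H.uncurry (H.mp (H.impH_replace_right (H.impH_replace_right h₁ h₂ γ)
    (H.impH_replace_right h₂ h₁ γ) α) (H.curry (H.and_left α γ)))

/-- `α` occurs twice in `α → (α ∧ γ)`; each occurrence is replaced separately. -/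
theorem impH_of_equiv_left (H : L.ExtendsDMSH) (h₁ : L.Provable (α ⇾ₕ β))
    (h₂ : L.Provable (β ⇾ₕ α)) (h : L.Provable (α ⇾ₕ γ)) : L.Provable (β ⇾ₕ γ) :=
  H.mp (H.imp_replace_right (H.le_and (H.and_left_of_equiv h₁ h₂ γ) (H.and_right α γ))
    (H.le_and (H.and_left_of_equiv h₂ h₁ γ) (H.and_right β γ)) β)
    (H.mp (H.imp_replace_left h₁ h₂ (α ⋏ γ)) h)

/-- The axioms let `→` respect equivalence without giving monotonicity. But `α →_H β` makes `α`
equivalent to `α ∧ β`, and `α ∧ β` entails `γ`. -/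
theorem trans (H : L.ExtendsDMSH) (h₁ : L.Provable (α ⇾ₕ β)) (h₂ : L.Provable (β ⇾ₕ γ)) :
    L.Provable (α ⇾ₕ γ) :=
  H.impH_of_equiv_left (H.and_left α β) (H.le_and (H.refl α) h₁) (H.uncurry (H.imp_intro α h₂))

theorem mp_iff (H : L.ExtendsDMSH) (h : L.Provable (α ⇿ₕ β)) : L.Provable (α ⇾ₕ β) :=
  H.mp (H.and_left _ _) h

theorem mpr_iff (H : L.ExtendsDMSH) (h : L.Provable (α ⇿ₕ β)) : L.Provable (β ⇾ₕ α) :=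
  H.mp (H.and_right _ _) h

theorem bot_impH (H : L.ExtendsDMSH) (α : Fm V) : L.Provable (bot ⇾ₕ α) :=
  H.ax (.bot_elim α)

theorem inot_impH (H : L.ExtendsDMSH) (α : Fm V) : L.Provable (inot α ⇾ₕ (α ⇾ₕ bot)) :=
  H.imp_replace_right (H.bot_impH _) (H.and_right α bot) α

theorem impH_inot (H : L.ExtendsDMSH) (α : Fm V) : L.Provable ((α ⇾ₕ bot) ⇾ₕ inot α) :=
  H.imp_replace_right (H.and_right α bot) (H.bot_impH _) α

theorem neg_bot (H : L.ExtendsDMSH) : L.Provable (∼(bot : Fm V)) :=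
  H.mp (H.mp_iff (H.ax .neg_bot)) (H.ax .top_intro)

/-- The De Morgan negation of a theorem is refutable. -/
theorem neg_impH_bot (H : L.ExtendsDMSH) (h : L.Provable α) : L.Provable (∼α ⇾ₕ bot) :=
  H.trans (H.contra (H.imp_intro (∼bot) h)) (H.mp_iff (H.ax (.neg_neg bot)))

theorem not_provable_bot (H : L.ExtendsDMSH) (hc : L.Consistent) : ¬ L.Provable bot :=
  fun h => hc.elim fun φ hφ => hφ (H.mp (H.bot_impH φ) h)

/-- If `α` entails the pseudocomplement of `∼α`, then excluded middle for `∼` holds at `∼α`. -/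
theorem neg_or_neg_neg (H : L.ExtendsDMSH) (h : L.Provable (α ⇾ₕ inot (∼α))) :
    L.Provable (∼α ⋎ ∼(∼α)) :=
  H.mp (H.mp_iff (H.ax (.neg_and α (∼α))))
    (H.mp (H.contra (H.uncurry (H.trans h (H.inot_impH (∼α))))) H.neg_bot)

end ExtendsDMSH

end HilbertSystem

theorem theorem9p4 {V : Type*} [Nonempty V] (L : HilbertSystem V)
    (hL : L.IsAxiomaticExtension (logicRUNO1 V)) (hcons : L.Consistent) :
    ¬ L.DisjunctionProperty := by
  intro hdp
  have H := hL.extendsDMSH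
  have hbot := H.not_provable_bot hcons
  obtain ⟨p⟩ := ‹Nonempty V›
  have hlevel : L.Provable ((var p ⋏ inot (∼(var p))) ⇾ₕ inot (∼(var p ⋏ inot (∼(var p))))) :=
    H.mpr_iff (HilbertSystem.provable_of_mem_axioms (hL.1 (Or.inr (.level_one (var p)))))
  rcases hdp _ _ (H.neg_or_neg_neg hlevel) with h | h
  -- At `p := ⊤` both conjuncts are theorems, since `∼⊤` is refutable.
  · have h₁ : L.Provable (∼(top ⋏ inot (∼top))) := h.subst fun _ => top
    have ht : L.Provable top := H.ax .top_intro
    have h₂ : L.Provable (inot (∼top)) := H.mp (H.impH_inot _) (H.neg_impH_bot ht)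
    exact hbot (H.mp (H.neg_impH_bot (H.mp (H.le_and (H.refl top) (H.imp_intro _ h₂)) ht)) h₁)
  -- After double negation is removed, `p := ⊥` leaves `⊥` as a conjunct.
  · have h₁ : L.Provable (bot ⋏ inot (∼bot)) :=
      (H.mp (H.mp_iff (H.ax (.neg_neg _))) h).subst fun _ => bot
    exact hbot (H.mp (H.and_left _ _) h₁)
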